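/- Consider $n$ agents with independent non-negative private values $v_1,\dots,v_n$, where $v_i$ has distribution function $F_i$ and density $f_i$, and a non-empty family $\mathcal F\subseteq 2^{[n]}$ of feasible sets of agents that may be served simultaneously. Suppose that $\mathcal F$ is downward-closed (every subset of a feasible set is feasible), and let $c>0$. Suppose that every $v_i$ is $c$-bounded, that is, $\mathbb E[v_i]\le c\cdot\sup_{p\ge 0} p\,(1-F_i(p))$, and hyper-regular, that is, with the virtual valuation $\phi_i(x)=x-\frac{1-F_i(x)}{f_i(x)}$, both $\phi_i(x)$ and $\phi_i(x)/x$ are non-decreasing on the range of values of $v_i$ (the $x$ with $0<F_i(x)<1$). A mechanism maps each bid vector $b\in\mathbb R^n$, possibly at random, to a set in $\mathcal F$ of agents to be served and to payments $p_i(b)\in\mathbb R$; it is ex post individually rational: a served agent never pays more than her bid, and an agent who is not served never pays a positive amount. An agent with value $v_i$ who is served with probability $\pi_i$ and pays $p_i$ in expectation has utility $\pi_i v_i-p_i$. The revenue of the optimal mechanism is the supremum of the expected total payment $\mathbb E[\sum_i p_i(b)]$ over all such mechanisms and all their Bayes–Nash equilibria (in possibly mixed strategies, with finite expected payments). Then $$\text{revenue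 of the optimal mechanism}\;\ge\;\frac1c\;\mathbb E\Big[\max_{S\in\mathcal F}\sum_{i\in S}v_i\Big],$$ that is, it is at least $1/c$ times the expected welfare of the efficient allocation. -/

import Mathlib

open MeasureTheory ProbabilityTheory Set
open scoped ENNReal unitInterval

noncomputable section

/-! ### Value distributions

A value distribution is a probability measure `μ` on `ℝ`; its distribution function is `cdf μ`. -/

/-- The optimal single-agent revenue `ρ = sup_{p ≥ 0} p (1 - F(p))`, in `[0, ∞]`. -/
def monopolyRevenue (μ : Measure ℝ) : ℝ≥0∞ :=
  ⨆ (p : ℝ) (_ : 0 ≤ p), ENNReal.ofReal (p * (1 - cdf μ p))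

/-- `μ` is `c`-bounded: `E[X] ≤ c · ρ(X)` for `X` nonnegative with law `μ`. -/
def IsCBounded (c : ℝ) (μ : Measure ℝ) : Prop :=
  ∫⁻ x, ENNReal.ofReal x ∂μ ≤ ENNReal.ofReal c * monopolyRevenue μ

/-- The hazard rate `h(x) = f(x) / (1 - F(x))` of a distribution `μ` with density `f`. -/
def hazardRate (μ : Measure ℝ) (f : ℝ → ℝ) (x : ℝ) : ℝ :=
  f x / (1 - cdf μ x)

/-- The virtual valuation `φ(x) = x - 1 / h(x)`. -/
def virtualValue (μ : Measure ℝ) (f : ℝ → ℝ) (x : ℝ) : ℝ :=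
  x - 1 / hazardRate μ f x

/-- The interior of the range of values: the points where `0 < F(x) < 1`. For a distribution with
a density this is an open interval of full measure. -/
def valueRange (μ : Measure ℝ) : Set ℝ :=
  {x | 0 < cdf μ x ∧ cdf μ x < 1}

/-- `μ` has density `f`, and its virtual valuation is finite on the range of values and
nondecreasing there. (At a point with `F < 1` and `f = 0` the virtual valuation is `-∞`; by
monotonicity this can only happen below the range of values, so positivity of `f` on the range is
part of monotonicity, stated separately because real division by zero is `0`.) -/
structure IsRegularWithDensity (μ : Measure ℝ) (f : ℝ → ℝ) : Prop where
  measurable : Measurable f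
  nonneg : ∀ x, 0 ≤ f x
  eq_withDensity : μ = volume.withDensity (fun x => ENNReal.ofReal (f x))
  pos : ∀ x ∈ valueRange μ, 0 < f x
  monotone : MonotoneOn (virtualValue μ f) (valueRange μ)

/-- A hyper-regular distribution: a regular distribution for which `φ(x) / x` is nondecreasing. -/
def IsHyperRegular (μ : Measure ℝ) : Prop :=
  ∃ f : ℝ → ℝ, IsRegularWithDensity μ f ∧
    MonotoneOn (fun x => virtualValue μ f x / x) (valueRange μ)

/-! ### Mechanisms -/

/-- A (possibly randomized) ex post individually rational mechanism for `n` agents with feasible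
sets `𝓕`. The mechanism's random choices are driven by a seed, uniform in `[0, 1]`. For bid vector
`b` and seed `ω` it serves the agents in `alloc b ω` and charges agent `i` the amount
`pay b ω i`, which may be negative. -/
structure SingleParamMechanism (n : ℕ) (𝓕 : Set (Finset (Fin n))) where
  alloc : (Fin n → ℝ) → I → Finset (Fin n)
  pay : (Fin n → ℝ) → I → Fin n → ℝ
  alloc_mem : ∀ b ω, alloc b ω ∈ 𝓕
  measurableSet_alloc : ∀ i, MeasurableSet {z : (Fin n → ℝ) × I | i ∈ alloc z.1 z.2}
  measurable_pay : ∀ i, Measurable fun z : (Fin n → ℝ) × I => pay z.1 z.2 i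
  pay_le : ∀ b ω i, pay b ω i ≤ if i ∈ alloc b ω then b i else 0

/-- The probability space of an environment with independent values `v i ∼ μ i`: a sample is
`(v, r, ω)` with `v` the value vector, `r` the agents' private (independent, uniform) seeds for
mixing their bids, and `ω` the mechanism's seed. -/
def envMeasure {n : ℕ} (μ : Fin n → Measure ℝ) :
    Measure ((Fin n → ℝ) × (Fin n → I) × I) :=
  (Measure.pi μ).prod ((volume : Measure (Fin n → I)).prod (volume : Measure I))

/-- The bid vector when agent `i` uses the (mixed) strategy `s i : value → private seed → bid`. -/
def bidVector {n : ℕ} (s : Fin n → ℝ → I → ℝ) (v : Fin n → ℝ) (r : Fin n → I) : Fin n → ℝ :=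
  fun i => s i (v i) (r i)

namespace SingleParamMechanism

variable {n : ℕ} {𝓕 : Set (Finset (Fin n))}

/-- Quasi-linear utility of agent `i` with value `x`, at bid vector `b` and seed `ω`. -/
def utility (M : SingleParamMechanism n 𝓕) (i : Fin n) (x : ℝ) (b : Fin n → ℝ) (ω : I) : ℝ :=
  (if i ∈ M.alloc b ω then x else 0) - M.pay b ω i

/-- Expected utility of agent `i` with value `x` who bids `y` while every other agent `j` bids
according to `s j`. (The integrand does not depend on agent `i`'s own components of the sample.) -/
def interimUtility (M : SingleParamMechanism n 𝓕) (μ : Fin n → Measure ℝ)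
    (s : Fin n → ℝ → I → ℝ) (i : Fin n) (x y : ℝ) : ℝ :=
  ∫ z, M.utility i x (Function.update (bidVector s z.1 z.2.1) i y) z.2.2 ∂(envMeasure μ)

/-- Bayes–Nash equilibrium in (possibly mixed) strategies, with finite expected payments both ex
ante and for each agent and each bid of that agent: almost every value of every agent only uses
bids that are best responses to the strategies of the others. -/
structure IsEquilibrium (M : SingleParamMechanism n 𝓕) (μ : Fin n → Measure ℝ)
    (s : Fin n → ℝ → I → ℝ) : Prop where
  measurable : ∀ i, Measurable (Function.uncurry (s i))
  integrable_pay : ∀ i,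
    Integrable (fun z => M.pay (bidVector s z.1 z.2.1) z.2.2 i) (envMeasure μ)
  integrable_pay_bid : ∀ i y,
    Integrable (fun z => M.pay (Function.update (bidVector s z.1 z.2.1) i y) z.2.2 i)
      (envMeasure μ)
  best_response : ∀ i, ∀ᵐ t ∂((μ i).prod (volume : Measure I)), ∀ y : ℝ,
    M.interimUtility μ s i t.1 y ≤ M.interimUtility μ s i t.1 (s i t.1 t.2)

/-- The expected revenue of `M` when bids are given by `s`. -/
def revenue (M : SingleParamMechanism n 𝓕) (μ : Fin n → Measure ℝ)
    (s : Fin n → ℝ → I → ℝ) : ℝ :=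
  ∫ z, ∑ i, M.pay (bidVector s z.1 z.2.1) z.2.2 i ∂(envMeasure μ)

end SingleParamMechanism

/-- The revenue of the optimal mechanism: the supremum of the expected revenue over all
mechanisms with feasible sets `𝓕` and all their equilibria. -/
def optimalRevenue {n : ℕ} (𝓕 : Set (Finset (Fin n))) (μ : Fin n → Measure ℝ) : EReal :=
  ⨆ (M : SingleParamMechanism n 𝓕) (s : Fin n → ℝ → I → ℝ) (_ : M.IsEquilibrium μ s),
    ((M.revenue μ s : ℝ) : EReal)

/-- The expected welfare of the efficient allocation, `E[max_{S ∈ 𝓕} ∑_{i ∈ S} v i]`, for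
independent nonnegative values `v i ∼ μ i`. -/
def efficientWelfare {n : ℕ} (𝓕 : Set (Finset (Fin n))) (μ : Fin n → Measure ℝ) : ℝ≥0∞ :=
  ∫⁻ v, ⨆ S ∈ 𝓕, ENNReal.ofReal (∑ i ∈ S, v i) ∂(Measure.pi μ)

end

/-! Run the efficient auction with suitable reserves `r i`: agent `i` pays `max (r i) t`, where `t`
is the threshold set by the other bids. Truth-telling is dominant, so conditionally on those bids
she yields `postedRevenue (max (r i) t)`, while her share of the efficient welfare is `tailMean t`.
It suffices to compare these two functions agent by agent.

Write R for `postedRevenue`, G for `tailMean`, H for `survivalIntegral`; then G = R + H on t ≥ 0.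
Since φ(x)/x = 1 - (1 - F(x))/(x f(x)), hyper-regularity makes (1 - F(x))/(x f(x)) nonincreasing.
Hence H/G, a ratio of tail integrals of these two functions, is nonincreasing, so R/G is
nondecreasing. With a < 1/c, `c`-boundedness provides r with R(r) ≥ a G(0). For t ≤ r this gives
R(r) ≥ a G(t); for t ≥ r, monotonicity gives R(t)/G(t) ≥ R(r)/G(r) ≥ a
(`IsHyperRegular.exists_reserve`). Summing over agents and letting a tend to 1/c finishes the proof
when means are finite. If a serviceable agent has infinite mean, posted prices to her alone already
earn unbounded revenue. -/

/-- The expected revenue of a posted price `p` offered to an agent with value distribution `μ`. -/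
noncomputable def postedRevenue (μ : Measure ℝ) (p : ℝ) : ℝ≥0∞ := ENNReal.ofReal p * μ (Ioi p)

/-- The contribution to the mean of `μ` of the values above `t`. -/
noncomputable def tailMean (μ : Measure ℝ) (t : ℝ) : ℝ≥0∞ := ∫⁻ x in Ioi t, ENNReal.ofReal x ∂μ

/-- The integral above `t` of the survival function of `μ`. -/
noncomputable def survivalIntegral (μ : Measure ℝ) (t : ℝ) : ℝ≥0∞ := ∫⁻ x in Ioi t, μ (Ioi x)

/-! ### Single agent: revenue, tail mean and the reserve price. -/

section SingleAgent

variable {μ : Measure ℝ}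

theorem ofReal_one_sub_cdf [IsProbabilityMeasure μ] (x : ℝ) :
    ENNReal.ofReal (1 - cdf μ x) = μ (Ioi x) := by
  rw [← compl_Iic, prob_compl_eq_one_sub measurableSet_Iic, ← ofReal_cdf,
    ENNReal.ofReal_sub _ (cdf_nonneg μ x), ENNReal.ofReal_one]

theorem ofReal_mul_one_sub_cdf [IsProbabilityMeasure μ] {p : ℝ} (hp : 0 ≤ p) :
    ENNReal.ofReal (p * (1 - cdf μ p)) = postedRevenue μ p := by
  rw [ENNReal.ofReal_mul hp, ofReal_one_sub_cdf, postedRevenue]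

theorem tailMean_le_lintegral (t : ℝ) : tailMean μ t ≤ ∫⁻ x, ENNReal.ofReal x ∂μ :=
  setLIntegral_le_lintegral _ _

/-- Layer-cake formula for the identity cut off below `t`: each level in `(0, t]` contributes `μ
(Ioi t)`, and a level `u > t` contributes `μ (Ioi u)`. -/
theorem tailMean_eq_postedRevenue_add {t : ℝ} (ht : 0 ≤ t) :
    tailMean μ t = postedRevenue μ t + survivalIntegral μ t := by
  have hm : Measurable fun x : ℝ => (Ioi t).indicator id x :=
    measurable_id.indicator measurableSet_Ioi
  have h := lintegral_eq_lintegral_meas_lt μ (f := (Ioi t).indicator id)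
    (Filter.Eventually.of_forall fun x => indicator_nonneg (fun y hy => ht.trans (le_of_lt hy)) x)
    hm.aemeasurable
  have h₁ : ∫⁻ x, ENNReal.ofReal ((Ioi t).indicator id x) ∂μ = tailMean μ t := by
    rw [tailMean, ← lintegral_indicator measurableSet_Ioi]
    congr 1 with x
    by_cases hx : x ∈ Ioi t <;> simp [hx]
  rw [← h₁, h, ← Ioc_union_Ioi_eq_Ioi ht,
    lintegral_union measurableSet_Ioi (Set.Ioc_disjoint_Ioi le_rfl)]
  congr 1
  · rw [setLIntegral_congr_fun (g := fun _ => μ (Ioi t)) measurableSet_Ioc]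
    · simp [postedRevenue, mul_comm]
    · intro u hu
      dsimp only
      congr 1 with x
      simp only [mem_ofPred_eq, indicator_apply, mem_Ioi, id]
      split_ifs with hx
      · simp [hx, hu.2.trans_lt hx]
      · simp [hx, hu.1.le]
  · refine setLIntegral_congr_fun measurableSet_Ioi fun u hu => ?_
    congr 1 with x
    simp only [mem_ofPred_eq, indicator_apply, mem_Ioi, id]
    split_ifs with hx
    · rfl
    · have := mem_Ioi.1 hu
      constructor <;> intro <;> linarith

/-- The set where F vanishes is a lower ray: a countable union of null rays and at most one
endpoint, which is not an atom. -/
theorem ae_cdf_pos [IsProbabilityMeasure μ] [NullSingletonClass μ] : ∀ᵐ x ∂μ, 0 < cdf μ x := by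
  set L : Set ℝ := {x | cdf μ x ≤ 0} with hL
  have hzero : ∀ x ∈ L, μ (Iic x) = 0 := fun x hx => by
    rw [← ofReal_cdf, ENNReal.ofReal_eq_zero]; exact hx
  suffices h : μ L = 0 by
    rw [ae_iff]; simpa [hL] using h
  by_cases hne : L.Nonempty
  swap
  · rw [not_nonempty_iff_eq_empty.1 hne, measure_empty]
  by_cases hb : BddAbove L
  · obtain ⟨u, -, hu, huL⟩ := exists_seq_tendsto_sSup hne hb
    have hsub : L ⊆ {sSup L} ∪ ⋃ m, Iic (u m) := by
      intro x hx
      rcases (le_csSup hb hx).eq_or_lt with h | h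
      · exact Or.inl h
      · obtain ⟨m, hm⟩ := (hu.eventually_const_lt h).exists
        exact Or.inr (mem_iUnion.2 ⟨m, hm.le⟩)
    refine measure_mono_null hsub (measure_union_null (measure_singleton _) ?_)
    exact measure_iUnion_null fun m => hzero _ (huL m)
  · have hsub : L ⊆ ⋃ m : ℕ, Iic (m : ℝ) := fun x _ => by
      obtain ⟨m, hm⟩ := exists_nat_ge x
      exact mem_iUnion.2 ⟨m, hm⟩
    refine measure_mono_null hsub (measure_iUnion_null fun m => ?_)
    obtain ⟨y, hy, hmy⟩ := not_bddAbove_iff.1 hb m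
    exact measure_mono_null (Iic_subset_Iic.2 hmy.le) (hzero y hy)

theorem IsRegularWithDensity.nullSingletonClass {f : ℝ → ℝ} (h : IsRegularWithDensity μ f) : NullSingletonClass μ :=
  ⟨fun x => by
    rw [h.eq_withDensity]
    exact withDensity_absolutelyContinuous _ _ (measure_singleton x)⟩

theorem pos_of_mem_valueRange [IsProbabilityMeasure μ] [NullSingletonClass μ] (h0 : μ (Iio 0) = 0) {x : ℝ}
    (hx : x ∈ valueRange μ) : 0 < x := by
  by_contra hx0
  have h : μ (Iic x) = 0 := by
    refine measure_mono_null (Iic_subset_Iic.2 (not_lt.1 hx0)) ?_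
    rw [measure_congr (Iio_ae_eq_Iic (μ := μ) (a := (0 : ℝ))).symm, h0]
  rw [← ofReal_cdf, ENNReal.ofReal_eq_zero] at h
  exact h.not_gt hx.1

theorem virtualValue_div {f : ℝ → ℝ} {x : ℝ} (hx : x ≠ 0) :
    virtualValue μ f x / x = 1 - (1 - cdf μ x) / (x * f x) := by
  rw [virtualValue, hazardRate, one_div_div, sub_div, div_self hx, div_div, mul_comm x]

theorem IsHyperRegular.nullSingletonClass (h : IsHyperRegular μ) : NullSingletonClass μ := by
  obtain ⟨f, hf, -⟩ := h
  exact hf.nullSingletonClass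

/-- For a hyper-regular distribution the ratio `survivalIntegral / tailMean` is nonincreasing. -/
theorem IsHyperRegular.survivalIntegral_mul_tailMean_le [IsProbabilityMeasure μ]
    (hμ : IsHyperRegular μ) (h0 : μ (Iio 0) = 0) {s t : ℝ} (hs : 0 ≤ s) (hst : s ≤ t)
    (ht : t ∈ valueRange μ) :
    survivalIntegral μ t * tailMean μ s ≤ survivalIntegral μ s * tailMean μ t := by
  obtain ⟨f, hf, hmono⟩ := hμ
  have := hf.nullSingletonClass
  have ht0 : 0 < t := pos_of_mem_valueRange h0 ht
  have hfm : Measurable fun x => ENNReal.ofReal (f x) := hf.measurable.ennreal_ofReal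
  -- `k` is the value at `t` of (1 - F(x))/(x f(x)), that is, 1 - φ(t)/t. It separates the ratios on
  -- the two sides of `t`.
  set k : ℝ := (1 - cdf μ t) / (t * f t) with hk
  have hk0 : 0 ≤ k := div_nonneg (by linarith [ht.2]) (mul_nonneg ht0.le (hf.nonneg t))
  have hupper : ∀ x ∈ valueRange μ, t ≤ x → 1 - cdf μ x ≤ k * (x * f x) := by
    intro x hx htx
    have hx0 := pos_of_mem_valueRange h0 hx
    have h := hmono ht hx htx
    simp only [virtualValue_div hx0.ne', virtualValue_div ht0.ne'] at h
    rw [← div_le_iff₀ (mul_pos hx0 (hf.pos x hx))]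
    linarith
  have hlower : ∀ x ∈ valueRange μ, x ≤ t → k * (x * f x) ≤ 1 - cdf μ x := by
    intro x hx hxt
    have hx0 := pos_of_mem_valueRange h0 hx
    have h := hmono hx ht hxt
    simp only [virtualValue_div hx0.ne', virtualValue_div ht0.ne'] at h
    rw [← le_div_iff₀ (mul_pos hx0 (hf.pos x hx))]
    linarith
  have hdens : ∀ A : Set ℝ, MeasurableSet A → A ⊆ Ici 0 →
      ENNReal.ofReal k * ∫⁻ x in A, ENNReal.ofReal x ∂μ
        = ∫⁻ x in A, ENNReal.ofReal (k * (x * f x)) := by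
    intro A hA hA0
    conv_lhs => rw [hf.eq_withDensity]
    rw [setLIntegral_withDensity_eq_setLIntegral_mul _ hfm ENNReal.measurable_ofReal hA,
      ← lintegral_const_mul _ (hfm.mul ENNReal.measurable_ofReal)]
    refine setLIntegral_congr_fun hA fun x hx => ?_
    simp only [Pi.mul_apply]
    rw [ENNReal.ofReal_mul hk0, ENNReal.ofReal_mul (hA0 hx), mul_comm (ENNReal.ofReal x)]
  have htail : survivalIntegral μ t ≤ ENNReal.ofReal k * tailMean μ t := by
    rw [tailMean, hdens _ measurableSet_Ioi fun x hx => ht0.le.trans (le_of_lt hx)]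
    refine setLIntegral_mono' measurableSet_Ioi fun x hx => ?_
    rw [← ofReal_one_sub_cdf]
    rcases (cdf_le_one μ x).eq_or_lt with h1 | h1
    · simp [h1]
    · exact ENNReal.ofReal_le_ofReal
        (hupper x ⟨ht.1.trans_le (monotone_cdf μ (le_of_lt hx)), h1⟩ (le_of_lt hx))
  have hmid : ENNReal.ofReal k * ∫⁻ x in Ioc s t, ENNReal.ofReal x ∂μ
      ≤ ∫⁻ x in Ioc s t, μ (Ioi x) := by
    rw [hdens _ measurableSet_Ioc fun x hx => hs.trans hx.1.le]
    -- `hlower` needs F(x) > 0. Where F vanishes, f is zero almost everywhere and the bound is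
    -- trivial.
    have hae : ∀ᵐ x, f x ≠ 0 → 0 < cdf μ x := by
      have h := ae_cdf_pos (μ := μ)
      have h' : ∀ᵐ x ∂(volume.withDensity fun x => ENNReal.ofReal (f x)), 0 < cdf μ x := by
        rwa [← hf.eq_withDensity]
      filter_upwards [(ae_withDensity_iff hfm).1 h'] with x hx hfx
      exact hx (by simpa using lt_of_le_of_ne (hf.nonneg x) hfx.symm)
    refine setLIntegral_mono_ae' measurableSet_Ioc ?_
    filter_upwards [hae] with x hx hxm
    rw [← ofReal_one_sub_cdf]
    by_cases hfx : f x = 0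
    · simp [hfx]
    · exact ENNReal.ofReal_le_ofReal
        (hlower x ⟨hx hfx, (monotone_cdf μ hxm.2).trans_lt ht.2⟩ hxm.2)
  have hsplit : ∀ (ν : Measure ℝ) (g : ℝ → ℝ≥0∞),
      ∫⁻ x in Ioi s, g x ∂ν = ∫⁻ x in Ioc s t, g x ∂ν + ∫⁻ x in Ioi t, g x ∂ν := by
    intro ν g
    rw [← Ioc_union_Ioi_eq_Ioi hst,
      lintegral_union measurableSet_Ioi (Set.Ioc_disjoint_Ioi le_rfl)]
  have hG : tailMean μ s = ∫⁻ x in Ioc s t, ENNReal.ofReal x ∂μ + tailMean μ t := hsplit _ _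
  have hH : survivalIntegral μ s = (∫⁻ x in Ioc s t, μ (Ioi x)) + survivalIntegral μ t := hsplit _ _
  rw [hG, hH, mul_add, add_mul]
  gcongr ?_ + _
  calc survivalIntegral μ t * ∫⁻ x in Ioc s t, ENNReal.ofReal x ∂μ
      ≤ (ENNReal.ofReal k * tailMean μ t) * ∫⁻ x in Ioc s t, ENNReal.ofReal x ∂μ := by gcongr
    _ = (ENNReal.ofReal k * ∫⁻ x in Ioc s t, ENNReal.ofReal x ∂μ) * tailMean μ t := by ring
    _ ≤ (∫⁻ x in Ioc s t, μ (Ioi x)) * tailMean μ t := by gcongr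

/-- For a hyper-regular distribution the ratio `postedRevenue / tailMean` is nondecreasing. -/
theorem IsHyperRegular.postedRevenue_mul_tailMean_le [IsProbabilityMeasure μ]
    (hμ : IsHyperRegular μ) (h0 : μ (Iio 0) = 0) (hfin : ∫⁻ x, ENNReal.ofReal x ∂μ ≠ ⊤)
    {s t : ℝ} (hs : 0 ≤ s) (hst : s ≤ t) :
    postedRevenue μ s * tailMean μ t ≤ postedRevenue μ t * tailMean μ s := by
  have ht := hs.trans hst
  by_cases htr : t ∈ valueRange μ
  · have hG := tailMean_eq_postedRevenue_add (μ := μ) hs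
    have hH := tailMean_eq_postedRevenue_add (μ := μ) ht
    have hGs : tailMean μ s ≠ ⊤ := ne_top_of_le_ne_top hfin (tailMean_le_lintegral s)
    have hGt : tailMean μ t ≠ ⊤ := ne_top_of_le_ne_top hfin (tailMean_le_lintegral t)
    have hHs : survivalIntegral μ s ≠ ⊤ := ne_top_of_le_ne_top hGs (hG ▸ le_add_self)
    -- Adding H(s) G(t) to both sides turns the claim into the monotonicity of H/G; cancelling it
    -- again requires finiteness.
    refine ENNReal.le_of_add_le_add_right (ENNReal.mul_ne_top hHs hGt) ?_
    calc postedRevenue μ s * tailMean μ t + survivalIntegral μ s * tailMean μ t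
        = tailMean μ s * tailMean μ t := by rw [← add_mul, ← hG]
      _ = postedRevenue μ t * tailMean μ s + survivalIntegral μ t * tailMean μ s := by
        rw [← add_mul, ← hH, mul_comm]
      _ ≤ _ := by
        exact add_le_add_right (hμ.survivalIntegral_mul_tailMean_le h0 hs hst htr) _
  -- Outside the range of values: if F(t) = 0, both prices always sell, so R is the identity there
  -- and G is nonincreasing; if F(t) = 1, then G(t) = 0.
  · rcases (cdf_nonneg μ t).eq_or_lt with h | h
    · have hIic : μ (Iic t) = 0 := by rw [← ofReal_cdf, ← h, ENNReal.ofReal_zero]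
      have hone : ∀ x ≤ t, μ (Ioi x) = 1 := fun x hx => by
        rw [← compl_Iic, prob_compl_eq_one_iff measurableSet_Iic]
        exact measure_mono_null (Iic_subset_Iic.2 hx) hIic
      simp only [postedRevenue, hone s hst, hone t le_rfl, mul_one]
      exact mul_le_mul' (ENNReal.ofReal_le_ofReal hst) (lintegral_mono_set (Ioi_subset_Ioi hst))
    · have h1 : μ (Ioi t) = 0 := by
        rw [← ofReal_one_sub_cdf, ENNReal.ofReal_eq_zero]
        by_contra hlt
        exact htr ⟨h, by linarith⟩
      simp [tailMean, Measure.restrict_eq_zero.2 h1]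

/-- The monopoly supremum need not be attained, so the reserve is only near-optimal; the slack `a <
1 / c` pays for this. -/
theorem IsHyperRegular.exists_reserve [IsProbabilityMeasure μ] (hμ : IsHyperRegular μ)
    (h0 : μ (Iio 0) = 0) (hfin : ∫⁻ x, ENNReal.ofReal x ∂μ ≠ ⊤) {c : ℝ}
    (hc : 0 < c) (hbdd : IsCBounded c μ) {a : ℝ≥0∞} (ha : a < ENNReal.ofReal (1 / c)) :
    ∃ r : ℝ, 0 ≤ r ∧ ∀ t, 0 ≤ t → a * tailMean μ t ≤ postedRevenue μ (max r t) := by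
  set E := ∫⁻ x, ENNReal.ofReal x ∂μ with hE
  by_cases hE0 : E = 0
  · refine ⟨0, le_rfl, fun t _ => ?_⟩
    have : tailMean μ t = 0 := le_antisymm ((tailMean_le_lintegral t).trans hE0.le) zero_le
    simp [this]
  have hlt : a * E < monopolyRevenue μ := by
    calc a * E < ENNReal.ofReal (1 / c) * E := ENNReal.mul_lt_mul_left hE0 hfin ha
      _ ≤ ENNReal.ofReal (1 / c) * (ENNReal.ofReal c * monopolyRevenue μ) := by
        gcongr; exact hbdd
      _ = monopolyRevenue μ := by
        rw [← mul_assoc, ← ENNReal.ofReal_mul (by positivity), one_div_mul_cancel hc.ne',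
          ENNReal.ofReal_one, one_mul]
  simp only [monopolyRevenue, lt_iSup_iff] at hlt
  obtain ⟨r, hr, hlt⟩ := hlt
  rw [ofReal_mul_one_sub_cdf hr] at hlt
  refine ⟨r, hr, fun t ht => ?_⟩
  have key : postedRevenue μ r * tailMean μ t ≤ postedRevenue μ (max r t) * E := by
    rcases le_total r t with h | h
    · rw [max_eq_right h]
      refine (hμ.postedRevenue_mul_tailMean_le h0 hfin hr h).trans ?_
      gcongr
      exact tailMean_le_lintegral r
    · rw [max_eq_left h]
      gcongr
      exact tailMean_le_lintegral t
  refine (ENNReal.mul_le_mul_iff_left hE0 hfin).1 ?_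
  calc a * tailMean μ t * E = a * E * tailMean μ t := by ring
    _ ≤ postedRevenue μ r * tailMean μ t := by gcongr
    _ ≤ _ := key

end SingleAgent

/-! ### Redrawing one agent's value independently. -/

section Resampling

variable {n : ℕ} (μ : Fin n → Measure ℝ)

theorem measurePreserving_fst_envMeasure :
    MeasurePreserving Prod.fst (envMeasure μ) (Measure.pi μ) :=
  measurePreserving_fst

variable [∀ i, IsProbabilityMeasure (μ i)]

/-- Independence in the form used for conditioning on the other values: the own coordinate is
discarded and redrawn, so Fubini applies without splitting the product. -/
theorem measurePreserving_update (i : Fin n) :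
    MeasurePreserving (fun z : (Fin n → ℝ) × ℝ => Function.update z.1 i z.2)
      ((Measure.pi μ).prod (μ i)) (Measure.pi μ) := by
  have hm : Measurable fun z : (Fin n → ℝ) × ℝ => Function.update z.1 i z.2 := measurable_update'
  refine ⟨hm, ?_⟩
  symm
  refine Measure.pi_eq fun s hs => ?_
  rw [Measure.map_apply hm (.univ_pi hs)]
  have hpre : (fun z : (Fin n → ℝ) × ℝ => Function.update z.1 i z.2) ⁻¹' univ.pi s
      = univ.pi (Function.update s i univ) ×ˢ s i := by
    ext ⟨v, x⟩
    simp only [mem_preimage, mem_univ_pi, mem_prod]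
    constructor
    · intro h
      refine ⟨fun j => ?_, by simpa using h i⟩
      by_cases hj : j = i
      · subst hj; simp
      · simpa [hj] using h j
    · rintro ⟨h, hx⟩ j
      by_cases hj : j = i
      · subst hj; simpa using hx
      · simpa [hj] using h j
  rw [hpre, Measure.prod_prod, Measure.pi_pi, ← Finset.prod_erase_mul _ _ (Finset.mem_univ i),
    ← Finset.prod_erase_mul _ (fun j => μ j (s j)) (Finset.mem_univ i)]
  simp only [Function.update_self, measure_univ, mul_one]
  congr 1
  refine Finset.prod_congr rfl fun j hj => ?_
  rw [Function.update_of_ne (Finset.ne_of_mem_erase hj)]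

theorem lintegral_pi_eq_lintegral_update (i : Fin n) {g : (Fin n → ℝ) → ℝ≥0∞}
    (hg : Measurable g) :
    ∫⁻ v, g v ∂Measure.pi μ = ∫⁻ v, ∫⁻ x, g (Function.update v i x) ∂μ i ∂Measure.pi μ := by
  rw [← (measurePreserving_update μ i).lintegral_comp hg]
  exact lintegral_prod _ (hg.comp (measurePreserving_update μ i).measurable).aemeasurable

instance isProbabilityMeasure_envMeasure : IsProbabilityMeasure (envMeasure μ) :=
  inferInstanceAs (IsProbabilityMeasure ((Measure.pi μ).prod (volume.prod volume)))

end Resampling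

/-! ### Threshold mechanisms: truthfulness and revenue. -/

/-- Data of a truthful mechanism: each of the listed agents is served when her bid exceeds a price
that depends only on the bids of the others. -/
structure ThresholdRule (n : ℕ) (𝓕 : Set (Finset (Fin n))) where
  agents : Finset (Fin n)
  price : Fin n → (Fin n → ℝ) → ℝ
  measurable_price : ∀ i, Measurable (price i)
  price_nonneg : ∀ i b, 0 ≤ price i b
  price_update : ∀ i b y, price i (Function.update b i y) = price i b
  winners_mem : ∀ b, {i ∈ agents | price i b < b i} ∈ 𝓕

namespace ThresholdRule

variable {n : ℕ} {𝓕 : Set (Finset (Fin n))} (T : ThresholdRule n 𝓕)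

noncomputable def winners (b : Fin n → ℝ) : Finset (Fin n) := {i ∈ T.agents | T.price i b < b i}

noncomputable def payment (b : Fin n → ℝ) (i : Fin n) : ℝ :=
  if i ∈ T.winners b then T.price i b else 0

theorem mem_winners {b : Fin n → ℝ} {i : Fin n} :
    i ∈ T.winners b ↔ i ∈ T.agents ∧ T.price i b < b i := by
  simp [winners]

theorem mem_winners_update {b : Fin n → ℝ} {i : Fin n} {y : ℝ} :
    i ∈ T.winners (Function.update b i y) ↔ i ∈ T.agents ∧ T.price i b < y := by
  rw [mem_winners, T.price_update, Function.update_self]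

theorem measurableSet_mem_winners (i : Fin n) : MeasurableSet {b | i ∈ T.winners b} := by
  simp only [mem_winners, ofPred_and]
  exact (MeasurableSet.const _).inter
    (measurableSet_lt (T.measurable_price i) (measurable_pi_apply i))

theorem measurable_payment (i : Fin n) : Measurable fun b => T.payment b i :=
  Measurable.ite (T.measurableSet_mem_winners i) (T.measurable_price i) measurable_const

theorem payment_nonneg (b : Fin n → ℝ) (i : Fin n) : 0 ≤ T.payment b i := by
  unfold payment
  split_ifs
  exacts [T.price_nonneg i b, le_rfl]

noncomputable def toMechanism : SingleParamMechanism n 𝓕 where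
  alloc b _ := T.winners b
  pay b _ i := T.payment b i
  alloc_mem b _ := T.winners_mem b
  measurableSet_alloc i := measurable_fst (T.measurableSet_mem_winners i)
  measurable_pay i := (T.measurable_payment i).comp measurable_fst
  pay_le b _ i := by
    unfold payment
    split_ifs with h
    exacts [(T.mem_winners.1 h).2.le, le_rfl]

theorem payment_update_le (b : Fin n → ℝ) (i : Fin n) (y : ℝ) :
    T.payment (Function.update b i y) i ≤ |y| := by
  unfold payment
  split_ifs with h
  · rw [T.price_update]
    exact (T.mem_winners_update.1 h).2.le.trans (le_abs_self y)
  · exact abs_nonneg y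

theorem utility_update (b : Fin n → ℝ) (i : Fin n) (x y : ℝ) (ω : I) :
    T.toMechanism.utility i x (Function.update b i y) ω
      = if i ∈ T.agents ∧ T.price i b < y then x - T.price i b else 0 := by
  simp only [SingleParamMechanism.utility, toMechanism, payment, mem_winners_update,
    T.price_update]
  split_ifs <;> simp

/-- Truth-telling is optimal pointwise: the own bid decides only whether to accept a fixed price,
and accepting is worthwhile exactly when the value is at least that price. -/
theorem utility_update_le (b : Fin n → ℝ) (i : Fin n) (x y : ℝ) (ω : I) :
    T.toMechanism.utility i x (Function.update b i y) ω
      ≤ T.toMechanism.utility i x (Function.update b i x) ω := by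
  simp only [utility_update]
  split_ifs with h₁ h₂ h₂
  · exact le_rfl
  · have := not_lt.1 fun h => h₂ ⟨h₁.1, h⟩
    linarith
  · linarith [h₂.2]
  · exact le_rfl

variable (μ : Fin n → Measure ℝ) [∀ i, IsProbabilityMeasure (μ i)]

theorem integrable_payment_update (i : Fin n) (y : ℝ) :
    Integrable (fun z : (Fin n → ℝ) × (Fin n → I) × I =>
      T.payment (Function.update z.1 i y) i) (envMeasure μ) := by
  have hm : Measurable fun z : (Fin n → ℝ) × (Fin n → I) × I =>
      T.payment (Function.update z.1 i y) i :=
    (T.measurable_payment i).comp ((measurable_update_left).comp measurable_fst)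
  refine Integrable.of_bound hm.aestronglyMeasurable |y| (Filter.Eventually.of_forall fun z => ?_)
  rw [Real.norm_of_nonneg (T.payment_nonneg _ _)]
  exact T.payment_update_le _ _ _

theorem integrable_utility_update (i : Fin n) (x y : ℝ) :
    Integrable (fun z : (Fin n → ℝ) × (Fin n → I) × I =>
      T.toMechanism.utility i x (Function.update z.1 i y) z.2.2) (envMeasure μ) := by
  refine Integrable.sub ?_ (T.integrable_payment_update μ i y)
  have hs : MeasurableSet {z : (Fin n → ℝ) × (Fin n → I) × I |
      i ∈ T.winners (Function.update z.1 i y)} :=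
    (measurable_update_left.comp measurable_fst) (T.measurableSet_mem_winners i)
  refine Integrable.of_bound
    (Measurable.ite hs measurable_const measurable_const).aestronglyMeasurable |x|
    (Filter.Eventually.of_forall fun z => ?_)
  split_ifs <;> simp

/-- Truthful bidding. -/
def truthful (n : ℕ) : Fin n → ℝ → I → ℝ := fun _ x _ => x

/-- Once the own value is redrawn, the price is a constant take-it-or-leave-it offer to a fresh
sample from `μ i`. -/
theorem lintegral_payment (i : Fin n) :
    ∫⁻ v, ENNReal.ofReal (T.payment v i) ∂Measure.pi μ
      = if i ∈ T.agents then ∫⁻ v, postedRevenue (μ i) (T.price i v) ∂Measure.pi μ else 0 := by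
  split_ifs with hi
  · rw [lintegral_pi_eq_lintegral_update μ i (T.measurable_payment i).ennreal_ofReal]
    refine lintegral_congr fun v => ?_
    rw [postedRevenue, ← lintegral_indicator_const measurableSet_Ioi]
    refine lintegral_congr fun x => ?_
    simp only [payment, mem_winners_update, hi, true_and, T.price_update, indicator_apply, mem_Ioi]
    split_ifs <;> simp
  · simp [payment, mem_winners, hi]

theorem integrable_payment (i : Fin n)
    (hfin : i ∈ T.agents → ∫⁻ v, postedRevenue (μ i) (T.price i v) ∂Measure.pi μ ≠ ⊤) :
    Integrable (fun v => T.payment v i) (Measure.pi μ) := by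
  rw [← lintegral_ofReal_ne_top_iff_integrable
    (T.measurable_payment i).aestronglyMeasurable
    (Filter.Eventually.of_forall fun v => T.payment_nonneg v i), lintegral_payment]
  split_ifs with hi
  exacts [hfin hi, ENNReal.zero_ne_top]

theorem isEquilibrium_truthful
    (hfin : ∀ i ∈ T.agents, ∫⁻ v, postedRevenue (μ i) (T.price i v) ∂Measure.pi μ ≠ ⊤) :
    T.toMechanism.IsEquilibrium μ (truthful n) where
  measurable _ := measurable_fst
  integrable_pay i :=
    (measurePreserving_fst_envMeasure μ).integrable_comp_of_integrable
      (T.integrable_payment μ i (hfin i))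
  integrable_pay_bid i y := T.integrable_payment_update μ i y
  best_response i := Filter.Eventually.of_forall fun t y =>
    integral_mono (T.integrable_utility_update μ i t.1 y) (T.integrable_utility_update μ i t.1 t.1)
      fun _ => T.utility_update_le _ _ _ _ _

theorem ofReal_revenue_truthful
    (hfin : ∀ i ∈ T.agents, ∫⁻ v, postedRevenue (μ i) (T.price i v) ∂Measure.pi μ ≠ ⊤) :
    ENNReal.ofReal (T.toMechanism.revenue μ (truthful n))
      = ∑ i ∈ T.agents, ∫⁻ v, postedRevenue (μ i) (T.price i v) ∂Measure.pi μ := by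
  have hint : Integrable (fun v => ∑ i, T.payment v i) (Measure.pi μ) :=
    integrable_finsetSum _ fun i _ => T.integrable_payment μ i (hfin i)
  have hrev : T.toMechanism.revenue μ (truthful n)
      = ∫ z, ((fun v => ∑ i, T.payment v i) ∘ Prod.fst) z ∂envMeasure μ := rfl
  rw [hrev, ofReal_integral_eq_lintegral_ofReal
    ((measurePreserving_fst_envMeasure μ).integrable_comp_of_integrable hint)
    (Filter.Eventually.of_forall fun _ => Finset.sum_nonneg fun i _ => T.payment_nonneg _ _)]
  have hm : ∀ i, Measurable fun v => ENNReal.ofReal (T.payment v i) := fun i =>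
    (T.measurable_payment i).ennreal_ofReal
  simp only [Function.comp_apply, ENNReal.ofReal_sum_of_nonneg fun i _ => T.payment_nonneg _ i]
  rw [(measurePreserving_fst_envMeasure μ).lintegral_comp
    (f := fun v => ∑ i, ENNReal.ofReal (T.payment v i)) (Finset.measurable_fun_sum _ fun i _ => hm i),
    lintegral_finsetSum _ fun i _ => hm i]
  simp [lintegral_payment]

theorem sum_postedRevenue_le_optimalRevenue
    (hfin : ∀ i ∈ T.agents, ∫⁻ v, postedRevenue (μ i) (T.price i v) ∂Measure.pi μ ≠ ⊤) :
    ((∑ i ∈ T.agents, ∫⁻ v, postedRevenue (μ i) (T.price i v) ∂Measure.pi μ : ℝ≥0∞) : EReal)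
      ≤ optimalRevenue 𝓕 μ := by
  have h0 : 0 ≤ T.toMechanism.revenue μ (truthful n) :=
    integral_nonneg fun _ => Finset.sum_nonneg fun i _ => T.payment_nonneg _ _
  rw [← T.ofReal_revenue_truthful μ hfin, EReal.coe_ennreal_ofReal, max_eq_left h0]
  exact le_iSup₂_of_le T.toMechanism (truthful n)
    (le_iSup_of_le (T.isEquilibrium_truthful μ hfin) le_rfl)

end ThresholdRule

/-! ### Efficiency thresholds and the welfare bound. -/

section EfficientAllocation

variable {n : ℕ} {𝓕 : Set (Finset (Fin n))}

/-- The bid above which agent `i` belongs to every efficient feasible set and below which she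
belongs to none, given the bids of the others. -/
noncomputable def efficiencyThreshold (𝓕 : Set (Finset (Fin n))) (i : Fin n) (b : Fin n → ℝ) : ℝ :=
  (⨆ S : {S // S ∈ 𝓕}, ∑ j ∈ S.1.erase i, b j)
    - ⨆ S : {S // S ∈ 𝓕 ∧ i ∈ S}, ∑ j ∈ S.1.erase i, b j

/-- The agents who can be served at all. -/
noncomputable def serviceableAgents (𝓕 : Set (Finset (Fin n))) : Finset (Fin n) := by
  classical exact {i | {i} ∈ 𝓕}

theorem mem_serviceableAgents {i : Fin n} : i ∈ serviceableAgents 𝓕 ↔ {i} ∈ 𝓕 := by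
  simp [serviceableAgents]

theorem measurable_efficiencyThreshold (i : Fin n) : Measurable (efficiencyThreshold 𝓕 i) := by
  unfold efficiencyThreshold
  exact (Measurable.iSup fun S => Finset.measurable_fun_sum _ fun j _ => measurable_pi_apply j).sub
    (Measurable.iSup fun S => Finset.measurable_fun_sum _ fun j _ => measurable_pi_apply j)

theorem efficiencyThreshold_update (i : Fin n) (b : Fin n → ℝ) (y : ℝ) :
    efficiencyThreshold 𝓕 i (Function.update b i y) = efficiencyThreshold 𝓕 i b := by
  have h : ∀ S : Finset (Fin n),
      ∑ j ∈ S.erase i, Function.update b i y j = ∑ j ∈ S.erase i, b j := fun S =>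
    Finset.sum_congr rfl fun j hj => Function.update_of_ne (Finset.ne_of_mem_erase hj) _ _
  simp only [efficiencyThreshold, h]

theorem exists_efficient_set (h𝓕 : 𝓕.Nonempty) (b : Fin n → ℝ) :
    ∃ S ∈ 𝓕, ∀ U ∈ 𝓕, ∑ j ∈ U, b j ≤ ∑ j ∈ S, b j :=
  Set.exists_max_image 𝓕 (fun S => ∑ j ∈ S, b j) 𝓕.toFinite h𝓕

theorem mem_of_efficiencyThreshold_lt {b : Fin n → ℝ}
    {S : Finset (Fin n)} (hS : S ∈ 𝓕) (hmax : ∀ U ∈ 𝓕, ∑ j ∈ U, b j ≤ ∑ j ∈ S, b j) {i : Fin n}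
    (hi : {i} ∈ 𝓕) (hlt : efficiencyThreshold 𝓕 i b < b i) : i ∈ S := by
  by_contra hiS
  -- If no feasible set contained `i`, the second supremum would be over an empty type and take the
  -- default value 0.
  have : Nonempty {S // S ∈ 𝓕 ∧ i ∈ S} := ⟨⟨{i}, hi, Finset.mem_singleton_self i⟩⟩
  have h₁ : ∑ j ∈ S, b j ≤ ⨆ S : {S // S ∈ 𝓕}, ∑ j ∈ S.1.erase i, b j := by
    refine le_ciSup_of_le (finite_range _).bddAbove ⟨S, hS⟩ ?_
    rw [Finset.erase_eq_of_notMem hiS]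
  have h₂ : (⨆ S : {S // S ∈ 𝓕 ∧ i ∈ S}, ∑ j ∈ S.1.erase i, b j) ≤ ∑ j ∈ S, b j - b i := by
    refine ciSup_le fun U => ?_
    have := hmax U.1 U.2.1
    rw [← Finset.sum_erase_add _ _ U.2.2] at this
    linarith
  unfold efficiencyThreshold at hlt
  linarith

/-- Downward closure enters here: `U.erase i` is feasible, so the first supremum does not exceed the
optimal welfare. -/
theorem efficiencyThreshold_le_of_mem (hdown : IsLowerSet 𝓕) {b : Fin n → ℝ}
    {S : Finset (Fin n)} (hS : S ∈ 𝓕) (hmax : ∀ U ∈ 𝓕, ∑ j ∈ U, b j ≤ ∑ j ∈ S, b j) {i : Fin n}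
    (hi : i ∈ S) : efficiencyThreshold 𝓕 i b ≤ b i := by
  have : Nonempty {S // S ∈ 𝓕} := ⟨⟨S, hS⟩⟩
  have h₁ : (⨆ S : {S // S ∈ 𝓕}, ∑ j ∈ S.1.erase i, b j) ≤ ∑ j ∈ S, b j :=
    ciSup_le fun U => hmax _ (hdown (Finset.erase_subset i U.1) U.2)
  have h₂ : ∑ j ∈ S.erase i, b j ≤ ⨆ S : {S // S ∈ 𝓕 ∧ i ∈ S}, ∑ j ∈ S.1.erase i, b j :=
    le_ciSup_of_le (finite_range _).bddAbove ⟨S, hS, hi⟩ le_rfl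
  rw [← Finset.sum_erase_add _ _ hi] at h₁
  unfold efficiencyThreshold
  linarith

theorem efficiencyThreshold_nonneg {i : Fin n} (hi : {i} ∈ 𝓕) (b : Fin n → ℝ) :
    0 ≤ efficiencyThreshold 𝓕 i b := by
  have : Nonempty {S // S ∈ 𝓕 ∧ i ∈ S} := ⟨⟨{i}, hi, Finset.mem_singleton_self i⟩⟩
  exact sub_nonneg.2 (ciSup_le fun S =>
    le_ciSup_of_le (finite_range _).bddAbove ⟨S.1, S.2.1⟩ le_rfl)

/-- The efficient auction with reserve prices `r`. -/
noncomputable def efficientRuleWithReserves (h𝓕 : 𝓕.Nonempty) (hdown : IsLowerSet 𝓕)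
    (r : Fin n → ℝ) (hr : ∀ i, 0 ≤ r i) : ThresholdRule n 𝓕 where
  agents := serviceableAgents 𝓕
  price i b := max (r i) (efficiencyThreshold 𝓕 i b)
  measurable_price i := measurable_const.max (measurable_efficiencyThreshold i)
  price_nonneg i _ := (hr i).trans (le_max_left _ _)
  price_update i b y := by rw [efficiencyThreshold_update]
  winners_mem b := by
    -- All winners lie in one efficient set; reserves and ties only remove agents from it.
    obtain ⟨S, hS, hmax⟩ := exists_efficient_set h𝓕 b
    refine hdown (fun i hi => ?_) hS
    obtain ⟨hi, hlt⟩ := Finset.mem_filter.1 hi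
    exact mem_of_efficiencyThreshold_lt hS hmax (mem_serviceableAgents.1 hi)
      ((le_max_right _ _).trans_lt hlt)

/-- Offering the price `p` to agent `i` and serving nobody else. -/
noncomputable def postedPriceRule (hdown : IsLowerSet 𝓕) {i : Fin n} (hi : {i} ∈ 𝓕) (p : ℝ)
    (hp : 0 ≤ p) : ThresholdRule n 𝓕 where
  agents := {i}
  price _ _ := p
  measurable_price _ := measurable_const
  price_nonneg _ _ := hp
  price_update _ _ _ := rfl
  winners_mem _ := hdown (Finset.filter_subset _ _) hi

variable (μ : Fin n → Measure ℝ) [∀ i, IsProbabilityMeasure (μ i)]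

/-- Serves the infinite-mean case: each single posted price `p` has revenue at most `p`, hence
integrable payments, whatever the mean. -/
theorem monopolyRevenue_le_optimalRevenue (hdown : IsLowerSet 𝓕) {i : Fin n} (hi : {i} ∈ 𝓕) :
    (monopolyRevenue (μ i) : EReal) ≤ optimalRevenue 𝓕 μ := by
  have h : ∀ p : ℝ, 0 ≤ p → (postedRevenue (μ i) p : EReal) ≤ optimalRevenue 𝓕 μ := by
    intro p hp
    have h := (postedPriceRule hdown hi p hp).sum_postedRevenue_le_optimalRevenue μ fun j _ => by
      simp [postedPriceRule, postedRevenue, ENNReal.mul_eq_top]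
    simpa [postedPriceRule] using h
  have h0 : 0 ≤ optimalRevenue 𝓕 μ := (EReal.coe_ennreal_nonneg _).trans (h 0 le_rfl)
  have hle : monopolyRevenue (μ i) ≤ (optimalRevenue 𝓕 μ).toENNReal := by
    refine iSup₂_le fun p hp => ?_
    rw [ofReal_mul_one_sub_cdf hp, ← EReal.toENNReal_coe (x := postedRevenue (μ i) p)]
    exact EReal.toENNReal_le_toENNReal (h p hp)
  rw [← EReal.coe_toENNReal h0]
  exact_mod_cast hle

/-- Every member of an efficient set is serviceable and bids at least her threshold. Ties are
negligible because the laws have no atoms. -/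
theorem efficientWelfare_le_sum_tailMean [∀ i, NullSingletonClass (μ i)] (h𝓕 : 𝓕.Nonempty)
    (hdown : IsLowerSet 𝓕) :
    efficientWelfare 𝓕 μ ≤ ∑ i ∈ serviceableAgents 𝓕,
      ∫⁻ v, tailMean (μ i) (efficiencyThreshold 𝓕 i v) ∂Measure.pi μ := by
  set w : Fin n → (Fin n → ℝ) → ℝ≥0∞ := fun i v =>
    {v | efficiencyThreshold 𝓕 i v ≤ v i}.indicator (fun v => ENNReal.ofReal (v i)) v with hw
  have hwm : ∀ i, Measurable (w i) := fun i =>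
    (measurable_pi_apply i).ennreal_ofReal.indicator
      (measurableSet_le (measurable_efficiencyThreshold i) (measurable_pi_apply i))
  have hwint : ∀ i, ∫⁻ v, w i v ∂Measure.pi μ
      = ∫⁻ v, tailMean (μ i) (efficiencyThreshold 𝓕 i v) ∂Measure.pi μ := by
    intro i
    rw [lintegral_pi_eq_lintegral_update μ i (hwm i)]
    refine lintegral_congr fun v => ?_
    rw [tailMean, setLIntegral_congr Ioi_ae_eq_Ici, ← lintegral_indicator measurableSet_Ici]
    refine lintegral_congr fun x => ?_
    simp [hw, indicator_apply, efficiencyThreshold_update]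
  rw [← Finset.sum_congr rfl fun i _ => hwint i, ← lintegral_finsetSum _ fun i _ => hwm i]
  refine lintegral_mono fun v => iSup₂_le fun U hU => ?_
  obtain ⟨S, hS, hmax⟩ := exists_efficient_set h𝓕 v
  calc ENNReal.ofReal (∑ i ∈ U, v i) ≤ ENNReal.ofReal (∑ i ∈ S, v i) :=
        ENNReal.ofReal_le_ofReal (hmax U hU)
    -- Subadditivity, because individual coordinates of `v` may be negative here.
    _ ≤ ∑ i ∈ S, ENNReal.ofReal (v i) :=
        Finset.le_sum_of_subadditive _ ENNReal.ofReal_zero.le (fun _ _ => ENNReal.ofReal_add_le) _ _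
    _ = ∑ i ∈ S, w i v := Finset.sum_congr rfl fun i hi =>
        (indicator_of_mem (efficiencyThreshold_le_of_mem hdown hS hmax hi) _).symm
    _ ≤ ∑ i ∈ serviceableAgents 𝓕, w i v := by
        refine Finset.sum_le_sum_of_subset fun i hi => mem_serviceableAgents.2 ?_
        exact hdown (Finset.singleton_subset_iff.2 hi) hS

end EfficientAllocation

/-! ### Assembling the revenue guarantee. -/

theorem postedRevenue_le_lintegral (μ : Measure ℝ) {p : ℝ} (hp : 0 ≤ p) :
    postedRevenue μ p ≤ ∫⁻ x, ENNReal.ofReal x ∂μ := by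
  refine le_trans ?_ (tailMean_le_lintegral p)
  rw [tailMean_eq_postedRevenue_add hp]
  exact le_self_add

theorem theorem2 {n : ℕ} (𝓕 : Set (Finset (Fin n))) (h𝓕 : 𝓕.Nonempty) (hdown : IsLowerSet 𝓕)
    (μ : Fin n → Measure ℝ) [∀ i, IsProbabilityMeasure (μ i)]
    (hnonneg : ∀ i, μ i (Iio 0) = 0)
    (c : ℝ) (hc : 0 < c)
    (hbdd : ∀ i, IsCBounded c (μ i)) (hreg : ∀ i, IsHyperRegular (μ i)) :
    ((ENNReal.ofReal (1 / c) * efficientWelfare 𝓕 μ : ℝ≥0∞) : EReal) ≤ optimalRevenue 𝓕 μ := by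
  have := fun i => (hreg i).nullSingletonClass
  by_cases hfin : ∀ i ∈ serviceableAgents 𝓕, ∫⁻ x, ENNReal.ofReal x ∂μ i ≠ ⊤
  swap
  · push Not at hfin
    obtain ⟨i, hi, htop⟩ := hfin
    -- An infinite mean is compatible with `c`-boundedness only if the monopoly revenue is infinite.
    have hrev : monopolyRevenue (μ i) = ⊤ := by
      by_contra h
      have hle := hbdd i
      rw [IsCBounded, htop, top_le_iff] at hle
      exact ENNReal.mul_ne_top ENNReal.ofReal_ne_top h hle
    have h := monopolyRevenue_le_optimalRevenue μ hdown (mem_serviceableAgents.1 hi)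
    rw [hrev, EReal.coe_ennreal_top, top_le_iff] at h
    rw [h]
    exact le_top
  have key : ∀ a < ENNReal.ofReal (1 / c),
      ((a * efficientWelfare 𝓕 μ : ℝ≥0∞) : EReal) ≤ optimalRevenue 𝓕 μ := by
    intro a ha
    have hres : ∀ i, ∃ r : ℝ, 0 ≤ r ∧ (i ∈ serviceableAgents 𝓕 → ∀ t, 0 ≤ t →
        a * tailMean (μ i) t ≤ postedRevenue (μ i) (max r t)) := by
      intro i
      by_cases hi : i ∈ serviceableAgents 𝓕
      · obtain ⟨r, hr, h⟩ := (hreg i).exists_reserve (hnonneg i) (hfin i hi) hc (hbdd i) ha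
        exact ⟨r, hr, fun _ => h⟩
      · exact ⟨0, le_rfl, fun h => absurd h hi⟩
    choose r hr hres using hres
    set T := efficientRuleWithReserves h𝓕 hdown r hr with hT
    refine le_trans ?_ (T.sum_postedRevenue_le_optimalRevenue μ fun i hi => ?_)
    · refine EReal.coe_ennreal_le_coe_ennreal_iff.2 ?_
      calc a * efficientWelfare 𝓕 μ
          ≤ a * ∑ i ∈ serviceableAgents 𝓕,
              ∫⁻ v, tailMean (μ i) (efficiencyThreshold 𝓕 i v) ∂Measure.pi μ := by
            gcongr
            exact efficientWelfare_le_sum_tailMean μ h𝓕 hdown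
        _ ≤ ∑ i ∈ T.agents, ∫⁻ v, postedRevenue (μ i) (T.price i v) ∂Measure.pi μ := by
            rw [Finset.mul_sum]
            refine Finset.sum_le_sum fun i hi => ?_
            rw [← lintegral_const_mul' _ _ (ha.trans ENNReal.ofReal_lt_top).ne]
            exact lintegral_mono fun v => hres i hi _
              (efficiencyThreshold_nonneg (mem_serviceableAgents.1 hi) v)
    · refine ne_top_of_le_ne_top (hfin i hi) ?_
      calc ∫⁻ v, postedRevenue (μ i) (T.price i v) ∂Measure.pi μ
          ≤ ∫⁻ _, ∫⁻ x, ENNReal.ofReal x ∂μ i ∂Measure.pi μ :=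
            lintegral_mono fun v => postedRevenue_le_lintegral _ (T.price_nonneg i v)
        _ = ∫⁻ x, ENNReal.ofReal x ∂μ i := by simp
  -- The case `a = 0` gives nonnegativity, which allows the limit `a → 1 / c` to be taken in `ℝ≥0∞`.
  have h0 : 0 ≤ optimalRevenue 𝓕 μ := by
    simpa using key 0 (ENNReal.ofReal_pos.2 (one_div_pos.2 hc))
  rw [← EReal.coe_toENNReal h0, EReal.coe_ennreal_le_coe_ennreal_iff]
  refine ENNReal.mul_le_of_forall_lt fun a ha b hb => ?_
  have h := EReal.toENNReal_le_toENNReal (key a ha)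
  rw [EReal.toENNReal_coe] at h
  exact (mul_le_mul_right hb.le a).trans h
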